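/- Let $\mathcal H$ be a complex Hilbert space and $A_1^\circ$ a bounded linear operator on $\mathcal H$. Consider the AR equation $x_t=A_1^\circ x_{t-1}+\varepsilon_t$ with operator function $A(z)=I-zA_1^\circ$, and suppose that it is an AR with a unit root of finite type, that is: $A(1)\neq 0$; $A(1)$ is a Fredholm operator (its kernel has finite dimension, its image is closed and has finite codimension) with $A(1)v=0$ for some $v\ne 0$; and $A(z)$ is invertible for all $z\neq 1$ with $|z|<\rho$, for some $\rho>1$. Write $A(z)=\sum_{n\ge 0}A_n(1-z)^n$, so that $A_0=I-A_1^\circ$, $A_1=A_1^\circ$ and $A_n=0$ for $n\ge 2$. For a closed subspace $\eta$ let $P_\eta$ be the orthogonal projection onto $\eta$, and let $S^+$ denote the generalized (Moore–Penrose) inverse of an operator $S$ with closed range. Define recursively $S_0=A_0$, $A_{1,n}=A_n$ $(n\ge1)$ and, for $h\ge 1$, $$S_h=P_{\mathscr Z_h^\perp}A_{h,1}P_{\mathscr T_h^\perp},\qquad A_{h+1,n}=A_{h,n+1}-A_{h,1}\sum_{j=0}^{h-1}S_j^+A_{j+1,n}\quad(n\ge 1),$$ where $\zeta_h=\operatorname{Im}S_h$,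 $\tau_h=(\operatorname{Ker}S_h)^\perp$ for $h\ge0$, and $\mathscr Z_h=\zeta_0\oplus\dots\oplus\zeta_{h-1}$, $\mathscr T_h=\tau_0\oplus\dots\oplus\tau_{h-1}$. The point $1$ is then isolated in the spectrum of $A_1^\circ$, i.e. there is $r>0$ such that the closed disc $\{|w-1|\le r\}$ meets the spectrum of $A_1^\circ$ in $\{1\}$ only. For any such $r$ let $\mathcal H_P$ be the image of the Riesz projection $$\frac1{2\pi i}\oint_{|w-1|=r}(w I-A_1^\circ)^{-1}\,dw ,$$ and let $A_P:\mathcal H_P\to\mathcal H_P$ be the restriction of $A_1^\circ$ to $\mathcal H_P$. Then for every integer $d\ge 1$ the following are equivalent: (a) (Hu–Park $I(d)$ condition) $A_P-I$ is nilpotent of order $d$, i.e. $(A_P-I)^{d-1}\neq 0$ and $(A_P-I)^d=0$; (b) (pole-$d$ condition) $\mathcal H=\tau_0\oplus\tau_1\oplus\dots\oplus\tau_d$ is an orthogonal direct sum and $\tau_d\neq\{0\}$. -/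

import Mathlib

open scoped InnerProductSpace

noncomputable section

namespace FunctionalAR

variable {H : Type*} [NormedAddCommGroup H] [InnerProductSpace ℂ H] [CompleteSpace H]

/-! ### Autoregressive operator functions -/

/-- The operator function `A(z) = I - ∑_{h=1}^k z^h A°_h` of an AR with operators
`A°_1, …, A°_k`; here `a i` is `A°_{i+1}`. -/
def arFun {k : ℕ} (a : Fin k → H →L[ℂ] H) (z : ℂ) : H →L[ℂ] H :=
  1 - ∑ i : Fin k, z ^ (i.val + 1) • a i

/-- The coefficients `A_n` of the expansion `A(z) = ∑_n (1 - z)^n A_n`: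
`A_0 = I - ∑_h A°_h` and `A_n = (-1)^{n+1} ∑_{m=n}^{k} (m choose n) A°_m` for `n ≥ 1`
(the binomial coefficient vanishes for `m < n`). -/
def arCoeff {k : ℕ} (a : Fin k → H →L[ℂ] H) : ℕ → (H →L[ℂ] H)
  | 0 => 1 - ∑ i : Fin k, a i
  | n + 1 => (-1 : ℂ) ^ (n + 2) • ∑ i : Fin k, ((i.val + 1).choose (n + 1) : ℂ) • a i

/-- `z₀` is an eigenvalue of finite type of the operator function `W`. -/
structure IsEigenvalueOfFiniteType (W : ℂ → H →L[ℂ] H) (z₀ : ℂ) : Prop where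
  isFredholm : (W z₀).IsFredholm
  exists_ker : ∃ v : H, v ≠ 0 ∧ W z₀ v = 0
  invertible : ∃ δ > (0 : ℝ), ∀ z ∈ Metric.ball z₀ δ, z ≠ z₀ → IsUnit (W z)

/-- The AR with operators `A°_1, …, A°_k` has a unit root of finite type at `z = 1`:
`A(1) ≠ 0`, the point `1` is an eigenvalue of finite type of `A(z)`, and `A(z)` is invertible on
`D(0, ρ) \ {1}` for some `ρ > 1`. -/
structure HasUnitRootOfFiniteType {k : ℕ} (a : Fin k → H →L[ℂ] H) : Prop where
  ne_zero : arFun a 1 ≠ 0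
  finiteType : IsEigenvalueOfFiniteType (arFun a) 1
  invertible : ∃ ρ > (1 : ℝ), ∀ z ∈ Metric.ball (0 : ℂ) ρ, z ≠ 1 → IsUnit (arFun a z)

/-! ### The generalized (Moore–Penrose) inverse -/

/-- The four Penrose equations: `X` is the generalized inverse of `S`. -/
structure IsGenInv (S X : H →L[ℂ] H) : Prop where
  mul_mul_left : S * X * S = S
  mul_mul_right : X * S * X = X
  selfAdjoint_left : IsSelfAdjoint (S * X)
  selfAdjoint_right : IsSelfAdjoint (X * S)

theorem IsGenInv.unique {S X Y : H →L[ℂ] H} (hX : IsGenInv S X) (hY : IsGenInv S Y) : X = Y := by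
  have h1 : X * S = Y * S := by
    have hx := hX.selfAdjoint_right.star_eq
    have hy := hY.selfAdjoint_right.star_eq
    calc X * S = star (X * S) := hx.symm
      _ = star ((X * S) * (Y * S)) := by
        rw [mul_assoc X S, ← mul_assoc S Y S, hY.mul_mul_left]
      _ = (Y * S) * (X * S) := by rw [star_mul, hx, hy]
      _ = Y * S := by rw [mul_assoc Y S, ← mul_assoc S X S, hX.mul_mul_left]
  have h2 : S * X = S * Y := by
    have hx := hX.selfAdjoint_left.star_eq
    have hy := hY.selfAdjoint_left.star_eq
    calc S * X = star (S * X) := hx.symm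
      _ = star ((S * Y) * (S * X)) := by rw [← mul_assoc (S * Y) S, hY.mul_mul_left]
      _ = (S * X) * (S * Y) := by rw [star_mul, hx, hy]
      _ = S * Y := by rw [← mul_assoc (S * X) S, hX.mul_mul_left]
  calc X = X * S * X := hX.mul_mul_right.symm
    _ = Y * (S * Y) := by rw [h1, mul_assoc, h2]
    _ = Y := by rw [← mul_assoc, hY.mul_mul_right]

/-- A bounded operator with closed range has a (bounded) generalized inverse. -/
theorem exists_isGenInv {S : H →L[ℂ] H} (hS : IsClosed (S.range : Set H)) :
    ∃ X, IsGenInv S X := by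
  have : CompleteSpace S.range := hS.completeSpace_coe
  have hker : IsClosed (S.ker : Set H) := S.isClosed_ker
  have : CompleteSpace S.ker := hker.completeSpace_coe
  let f : S.kerᗮ →L[ℂ] S.range := (S ∘L S.kerᗮ.subtypeL).codRestrict S.range
    (fun x => ⟨x, rfl⟩)
  have hf : ∀ x : S.kerᗮ, ((f x : S.range) : H) = S x := fun x => rfl
  have hproj : ∀ x : H, S (S.kerᗮ.starProjection x) = S x := by
    intro x
    have h : x - S.kerᗮ.starProjection x ∈ S.ker := by
      have := S.kerᗮ.sub_starProjection_mem_orthogonal x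
      rwa [Submodule.orthogonal_orthogonal] at this
    have h' : S (x - S.kerᗮ.starProjection x) = 0 := h
    rw [map_sub, sub_eq_zero] at h'
    exact h'.symm
  have hinj : f.ker = ⊥ := by
    rw [eq_bot_iff]
    intro x hx
    have h0 : S x = 0 := by
      have : f x = 0 := hx
      rw [← hf, this]; rfl
    have : (x : H) ∈ S.ker ⊓ S.kerᗮ := ⟨h0, x.2⟩
    rw [Submodule.inf_orthogonal_eq_bot] at this
    exact Subtype.ext this
  have hsurj : f.range = ⊤ := by
    rw [eq_top_iff]
    rintro ⟨_, x, rfl⟩ -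
    refine ⟨⟨S.kerᗮ.starProjection x, Submodule.starProjection_apply_mem _ x⟩, ?_⟩
    exact Subtype.ext (hproj x)
  let e := ContinuousLinearEquiv.ofBijective f hinj hsurj
  have he : ∀ x, e x = f x := fun x => rfl
  let X : H →L[ℂ] H := S.kerᗮ.subtypeL ∘L (e.symm : S.range →L[ℂ] S.kerᗮ) ∘L
    S.range.orthogonalProjectionOnto
  have hSX : S * X = S.range.starProjection := by
    ext y
    change S (e.symm (S.range.orthogonalProjectionOnto y) : H) = _
    rw [← hf, ← he, e.apply_symm_apply]
    rfl
  have hXS : X * S = S.kerᗮ.starProjection := by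
    ext y
    change (e.symm (S.range.orthogonalProjectionOnto (S y)) : H) = _
    have h1 : S.range.orthogonalProjectionOnto (S y) = e (S.kerᗮ.orthogonalProjectionOnto y) := by
      apply Subtype.ext
      rw [he, hf]
      have h2 := Submodule.starProjection_eq_self_iff.2 (show S y ∈ S.range from ⟨y, rfl⟩)
      exact h2.trans (hproj y).symm
    rw [h1, e.symm_apply_apply]
    rfl
  refine ⟨X, ?_, ?_, ?_, ?_⟩
  · rw [mul_assoc, hXS]; ext y; exact hproj y
  · rw [hXS]; ext y
    exact Submodule.starProjection_eq_self_iff.2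
      (show X y ∈ S.kerᗮ from (e.symm (S.range.orthogonalProjectionOnto y)).2)
  · rw [hSX]; exact isSelfAdjoint_starProjection _
  · rw [hXS]; exact isSelfAdjoint_starProjection _

open Classical in
/-- The generalized inverse `S⁺`; it exists and is unique when `S` has closed range
(`exists_isGenInv`, `IsGenInv.unique`), and is set to `0` if there is none. -/
def genInv (S : H →L[ℂ] H) : H →L[ℂ] H :=
  if h : ∃ X, IsGenInv S X then h.choose else 0

theorem genInv_spec {S : H →L[ℂ] H} (hS : IsClosed (S.range : Set H)) :
    IsGenInv S (genInv S) := by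
  have h := exists_isGenInv hS
  rw [genInv, dif_pos h]
  exact h.choose_spec

/-! ### The operators `S_h`, `A_{h,n}` and the subspaces `ζ_h`, `τ_h`

For a sequence `A = (A_n)` of operators one sets `A_{1,n} = A_n`, `S_0 = A_0` and, for `h ≥ 1`,
`S_h = P_{𝒵_h^⊥} A_{h,1} P_{𝒯_h^⊥}`,
`A_{h+1,n} = A_{h,n+1} - A_{h,1} ∑_{j=0}^{h-1} S_j⁺ A_{j+1,n}`,
where `ζ_h = Im S_h`, `τ_h = (Ker S_h)^⊥`, `𝒵_h = ζ_0 ⊕ ⋯ ⊕ ζ_{h-1}` and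
`𝒯_h = τ_0 ⊕ ⋯ ⊕ τ_{h-1}`. The theorems `lrfS_zero`, `lrfS_succ`, `lrfA_one` and `lrfA_succ_succ`
state these equations for the definitions below. -/

/-- The orthogonal projection onto `K^⊥`. -/
def projPerp (K : Submodule ℂ H) : H →L[ℂ] H :=
  haveI : Kᗮ.HasOrthogonalProjection := .ofCompleteSpace Kᗮ
  Kᗮ.starProjection

/-- Stage `h` of the recursion: the operator `S_h` together with the sequence
`n ↦ A_{h+1,n}`. -/
def lrfStage (A : ℕ → H →L[ℂ] H) : ℕ → (H →L[ℂ] H) × (ℕ → H →L[ℂ] H)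
  | 0 => (A 0, A)
  | h + 1 =>
    (projPerp (⨆ j : Fin (h + 1), (lrfStage A j.val).1.range) * (lrfStage A h).2 1 *
        projPerp (⨆ j : Fin (h + 1), (lrfStage A j.val).1.kerᗮ),
      fun n => (lrfStage A h).2 (n + 1) -
        (lrfStage A h).2 1 *
          ∑ j : Fin (h + 1), genInv (lrfStage A j.val).1 * (lrfStage A j.val).2 n)

/-- The operator `S_h`. -/
def lrfS (A : ℕ → H →L[ℂ] H) (h : ℕ) : H →L[ℂ] H := (lrfStage A h).1

/-- The operator `A_{h,n}`, for `h, n ≥ 1`. -/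
def lrfA (A : ℕ → H →L[ℂ] H) (h n : ℕ) : H →L[ℂ] H := (lrfStage A (h - 1)).2 n

/-- `ζ_h = Im S_h`. -/
def zetaSub (A : ℕ → H →L[ℂ] H) (h : ℕ) : Submodule ℂ H := (lrfS A h).range

/-- `τ_h = (Ker S_h)^⊥`. -/
def tauSub (A : ℕ → H →L[ℂ] H) (h : ℕ) : Submodule ℂ H := (lrfS A h).kerᗮ

theorem lrfS_zero (A : ℕ → H →L[ℂ] H) : lrfS A 0 = A 0 := by
  rw [lrfS, lrfStage]

theorem lrfS_succ (A : ℕ → H →L[ℂ] H) (h : ℕ) :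
    lrfS A (h + 1) = projPerp (⨆ j : Fin (h + 1), zetaSub A j.val) * lrfA A (h + 1) 1 *
      projPerp (⨆ j : Fin (h + 1), tauSub A j.val) := by
  rw [lrfS, lrfStage]; rfl

theorem lrfA_one (A : ℕ → H →L[ℂ] H) (n : ℕ) : lrfA A 1 n = A n := by
  rw [lrfA, Nat.sub_self, lrfStage]

theorem lrfA_succ_succ (A : ℕ → H →L[ℂ] H) (h n : ℕ) :
    lrfA A (h + 2) n = lrfA A (h + 1) (n + 1) - lrfA A (h + 1) 1 *
      ∑ j : Fin (h + 1), genInv (lrfS A j.val) * lrfA A (j.val + 1) n := by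
  rw [lrfA, show h + 2 - 1 = h + 1 from rfl, lrfStage]; rfl

/-- The pole-`d` condition: `τ_d ≠ {0}` and `H = τ_0 ⊕ τ_1 ⊕ ⋯ ⊕ τ_d` is an orthogonal direct
sum, where the `τ_h` are computed from the coefficients `A_n` of `A(z) = ∑_n (1 - z)^n A_n`. -/
def PoleCondition {k : ℕ} (a : Fin k → H →L[ℂ] H) (d : ℕ) : Prop :=
  DirectSum.IsInternal (fun h : Fin (d + 1) => tauSub (arCoeff a) h.val) ∧
  (∀ i j : Fin (d + 1), i ≠ j → tauSub (arCoeff a) i.val ⟂ tauSub (arCoeff a) j.val) ∧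
  tauSub (arCoeff a) d ≠ ⊥

/-! ### The Riesz spectral subspace and the Hu–Park condition -/

/-- The closed disc of radius `r > 0` around `μ` meets the spectrum of `T` in the point `μ`
only. -/
def IsIsolatingRadius (T : H →L[ℂ] H) (μ : ℂ) (r : ℝ) : Prop :=
  0 < r ∧ Metric.closedBall μ r ∩ spectrum ℂ T = {μ}

/-- The Riesz projection `(2πi)⁻¹ ∮_{|w - μ| = r} (w - T)⁻¹ dw`. -/
def rieszProjection (T : H →L[ℂ] H) (μ : ℂ) (r : ℝ) : H →L[ℂ] H :=
  (2 * Real.pi * Complex.I : ℂ)⁻¹ • circleIntegral (fun w => resolvent T w) μ r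

/-- The image of the Riesz projection. -/
def rieszSubspace (T : H →L[ℂ] H) (μ : ℂ) (r : ℝ) : Submodule ℂ H :=
  (rieszProjection T μ r).range

theorem commute_resolvent (T : H →L[ℂ] H) (w : ℂ) : Commute T (resolvent T w) := by
  have h0 : Commute T (algebraMap ℂ (H →L[ℂ] H) w) := (Algebra.commutes w T).symm
  have h : Commute T (algebraMap ℂ (H →L[ℂ] H) w - T) := h0.sub_right (Commute.refl T)
  rw [resolvent]
  by_cases hu : IsUnit (algebraMap ℂ (H →L[ℂ] H) w - T)
  · obtain ⟨u, hu⟩ := hu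
    rw [← hu] at h ⊢
    rw [Ring.inverse_unit]
    exact h.units_inv_right
  · rw [Ring.inverse_non_unit _ hu]
    exact Commute.zero_right T

theorem commute_rieszProjection (T : H →L[ℂ] H) (μ : ℂ) (r : ℝ) :
    Commute T (rieszProjection T μ r) := by
  refine Commute.smul_right ?_ _
  rw [circleIntegral, intervalIntegral.integral_of_le Real.two_pi_pos.le]
  set f : ℝ → H →L[ℂ] H := fun θ => deriv (circleMap μ r) θ • resolvent T (circleMap μ r θ)
    with hf
  by_cases hi : MeasureTheory.IntegrableOn f (Set.Ioc 0 (2 * Real.pi))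
  · rw [Commute, SemiconjBy, ← integral_const_mul_of_integrable hi,
      ← integral_mul_const_of_integrable hi]
    congr 1
    ext1 θ
    exact ((commute_resolvent T _).smul_right _).eq
  · rw [MeasureTheory.integral_undef hi]
    exact Commute.zero_right T

/-- The Riesz subspace is invariant under `T`. -/
theorem rieszSubspace_invariant (T : H →L[ℂ] H) (μ : ℂ) (r : ℝ) :
    ∀ x ∈ rieszSubspace T μ r, (T : H →ₗ[ℂ] H) x ∈ rieszSubspace T μ r := by
  rintro _ ⟨y, rfl⟩
  refine ⟨T y, ?_⟩
  exact (DFunLike.congr_fun (commute_rieszProjection T μ r).eq y).symm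

/-- The restriction of `T` to its Riesz subspace, as an operator on that subspace. -/
def rieszRestrict (T : H →L[ℂ] H) (μ : ℂ) (r : ℝ) : Module.End ℂ (rieszSubspace T μ r) :=
  (T : H →ₗ[ℂ] H).restrict (rieszSubspace_invariant T μ r)

/-- The Hu–Park `I(d)` condition: `A_P - I` is nilpotent of order `d`, where `A_P` is the
restriction of `T` to the Riesz subspace of the eigenvalue `1` (with contour radius `r`). -/
def HuParkCondition (T : H →L[ℂ] H) (r : ℝ) (d : ℕ) : Prop :=
  (rieszRestrict T 1 r - 1) ^ (d - 1) ≠ 0 ∧ (rieszRestrict T 1 r - 1) ^ d = 0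

end FunctionalAR

end

open scoped InnerProductSpace

noncomputable section

namespace FunctionalAR

variable {H : Type*} [NormedAddCommGroup H] [InnerProductSpace ℂ H] [CompleteSpace H]

/-! ### Generalized inverses and orthogonality -/

namespace IsGenInv

variable {S X : H →L[ℂ] H}

/-! Write `D = 1 - T`, where `T` is the autoregressive operator. Both conditions say that the ascent
of `D` is exactly `d`: `Ker D^(d+1) = Ker D^d` but `Ker D^d ≠ Ker D^(d-1)`.

Pole condition. The `τ_h` are always mutually orthogonal, and the orthogonal complement of `τ_0 ⊕ ⋯
⊕ τ_n` is the common kernel of `S_0, …, S_n`. So the condition says that this kernel is zero for `n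
= d` and nonzero for `n = d - 1` (`poleDecomposition_iff`). The recursion for `S_h` is Gaussian
elimination on the equations of a Jordan chain, so the common kernel consists of the heads of chains
of length `n + 1` (`mem_commonKer_iff`). For the pencil `D + wT` with `w = 1 - z`, these heads form
`Ker D ∩ Im D^n`, which vanishes exactly when `Ker D^(n+1) = Ker D^n`
(`commonKer_pencil_eq_bot_iff`).

Hu–Park condition. The Riesz projection fixes every `Ker D^m`, by residues. If the ascent is at most
`n`, it kills `Im D^n`: there `D` is bounded below, so the resolvent stays bounded near `1` and the
singularity is removable. Since the projection commutes with `D`, nilpotency on its image is again a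
statement about the ascent (`huParkCondition_succ_iff`). -/

theorem apply_left (h : IsGenInv S X) (x : H) : S (X (S x)) = S x :=
  DFunLike.congr_fun h.mul_mul_left x

theorem apply_right (h : IsGenInv S X) (x : H) : X (S (X x)) = X x :=
  DFunLike.congr_fun h.mul_mul_right x

theorem inner_left (h : IsGenInv S X) (x y : H) : ⟪S (X x), y⟫_ℂ = ⟪x, S (X y)⟫_ℂ := by
  have := ContinuousLinearMap.adjoint_inner_left (S * X) y x
  rw [show ContinuousLinearMap.adjoint (S * X) = S * X from h.selfAdjoint_left.star_eq] at this
  exact this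

theorem inner_right (h : IsGenInv S X) (x y : H) : ⟪X (S x), y⟫_ℂ = ⟪x, X (S y)⟫_ℂ := by
  have := ContinuousLinearMap.adjoint_inner_left (X * S) y x
  rw [show ContinuousLinearMap.adjoint (X * S) = X * S from h.selfAdjoint_right.star_eq] at this
  exact this

/-- The generalized inverse vanishes on the orthogonal complement of the range. -/
theorem apply_eq_zero (h : IsGenInv S X) {z : H} (hz : z ∈ S.rangeᗮ) : X z = 0 := by
  have h0 : S (X z) = 0 := by
    rw [← inner_self_eq_zero (𝕜 := ℂ), ← h.inner_left, h.apply_left]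
    exact hz _ ⟨_, rfl⟩
  rw [← h.apply_right, h0, map_zero]

/-- The generalized inverse takes values in the orthogonal complement of the kernel. -/
theorem apply_mem (h : IsGenInv S X) (x : H) : X x ∈ S.kerᗮ := by
  intro k hk
  have hk' : S k = 0 := hk
  rw [← h.apply_right, ← h.inner_right, hk', map_zero, inner_zero_left]

theorem sub_mem_ker (h : IsGenInv S X) (x : H) : x - X (S x) ∈ S.ker := by
  change S (x - X (S x)) = 0
  rw [map_sub, h.apply_left, sub_self]

theorem sub_mem_orthogonal (h : IsGenInv S X) (x : H) : x - S (X x) ∈ S.rangeᗮ := by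
  rintro _ ⟨y, rfl⟩
  change ⟪S y, x - S (X x)⟫_ℂ = 0
  rw [inner_sub_right, ← h.inner_left, h.apply_left, sub_self]

end IsGenInv

/-! ### Projections onto orthogonal complements -/

theorem projPerp_mem (K : Submodule ℂ H) (x : H) : projPerp K x ∈ Kᗮ :=
  have : Kᗮ.HasOrthogonalProjection := .ofCompleteSpace Kᗮ
  Submodule.starProjection_apply_mem _ x

theorem projPerp_eq (K : Submodule ℂ H) {x u : H} (hu : u ∈ K) (h : x - u ∈ Kᗮ) :
    projPerp K x = x - u := by
  have : Kᗮ.HasOrthogonalProjection := .ofCompleteSpace Kᗮ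
  refine Submodule.eq_starProjection_of_mem_orthogonal h ?_
  rw [sub_sub_cancel]
  exact Submodule.le_orthogonal_orthogonal K hu

theorem projPerp_eq_zero (K : Submodule ℂ H) {x : H} (hx : x ∈ K) : projPerp K x = 0 := by
  rw [projPerp_eq K hx (by simp), sub_self]

/-! ### The subspaces `ζ_h` and `τ_h` -/

section Recursion

variable (A : ℕ → H →L[ℂ] H)

/-- The rightmost factor of `S_j` projects away every earlier `τ_i`, so `τ_i` lies in `Ker S_j`. -/
theorem tauSub_isOrtho_of_lt {i j : ℕ} (hij : i < j) : tauSub A i ⟂ tauSub A j := by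
  obtain ⟨j, rfl⟩ := Nat.exists_eq_succ_of_ne_zero (Nat.ne_of_gt (Nat.zero_lt_of_lt hij))
  rw [Submodule.isOrtho_iff_le]
  refine le_trans ?_ (Submodule.le_orthogonal_orthogonal _)
  intro x hx
  have hx' : x ∈ ⨆ k : Fin (j + 1), tauSub A k.val :=
    Submodule.mem_iSup_of_mem (⟨i, hij⟩ : Fin (j + 1)) hx
  change lrfS A (j + 1) x = 0
  rw [lrfS_succ]
  change projPerp _ (lrfA A (j + 1) 1 (projPerp _ x)) = 0
  rw [projPerp_eq_zero _ hx', map_zero, map_zero]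

theorem tauSub_isOrtho {i j : ℕ} (hij : i ≠ j) : tauSub A i ⟂ tauSub A j := by
  rcases lt_or_gt_of_ne hij with h | h
  · exact tauSub_isOrtho_of_lt A h
  · exact (tauSub_isOrtho_of_lt A h).symm

theorem zetaSub_isOrtho_of_lt {i j : ℕ} (hij : i < j) : zetaSub A i ⟂ zetaSub A j := by
  obtain ⟨j, rfl⟩ := Nat.exists_eq_succ_of_ne_zero (Nat.ne_of_gt (Nat.zero_lt_of_lt hij))
  rw [Submodule.isOrtho_comm, Submodule.isOrtho_iff_le]
  rintro _ ⟨x, rfl⟩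
  have h := projPerp_mem (⨆ k : Fin (j + 1), zetaSub A k.val)
    (lrfA A (j + 1) 1 (projPerp (⨆ k : Fin (j + 1), tauSub A k.val) x))
  have hle : zetaSub A i ≤ ⨆ k : Fin (j + 1), zetaSub A k.val :=
    le_iSup (fun k : Fin (j + 1) => zetaSub A k.val) ⟨i, hij⟩
  have := Submodule.orthogonal_le hle h
  rw [← mul_apply_eq_comp, ← mul_apply_eq_comp, ← lrfS_succ] at this
  exact this

theorem zetaSub_isOrtho {i j : ℕ} (hij : i ≠ j) : zetaSub A i ⟂ zetaSub A j := by
  rcases lt_or_gt_of_ne hij with h | h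
  · exact zetaSub_isOrtho_of_lt A h
  · exact (zetaSub_isOrtho_of_lt A h).symm

theorem tauSub_orthogonal (h : ℕ) : (tauSub A h)ᗮ = (lrfS A h).ker := by
  have : CompleteSpace (lrfS A h).ker := (lrfS A h).isClosed_ker.completeSpace_coe
  rw [tauSub, Submodule.orthogonal_orthogonal]

theorem lrfS_apply_eq_zero_of_mem_tauSub {i j : ℕ} (hij : i ≠ j) {x : H} (hx : x ∈ tauSub A i) :
    lrfS A j x = 0 := by
  have h := (Submodule.isOrtho_iff_le.1 (tauSub_isOrtho A hij)) hx
  rw [tauSub_orthogonal] at h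
  exact h

/-- If `A_0` has closed range and a finite-dimensional kernel, all `S_h` have closed range. -/
theorem isClosed_range_lrfS (h0 : IsClosed ((A 0).range : Set H))
    [FiniteDimensional ℂ (A 0).ker] (h : ℕ) : IsClosed ((lrfS A h).range : Set H) := by
  cases h with
  | zero => rwa [lrfS_zero]
  | succ h =>
    set P := projPerp (⨆ j : Fin (h + 1), tauSub A j.val)
    -- Every later `S_h` factors through `τ_0ᗮ = Ker A_0`, hence has finite rank.
    have hP : P.range ≤ (A 0).ker := by
      rintro _ ⟨x, rfl⟩
      have hle : tauSub A 0 ≤ ⨆ k : Fin (h + 1), tauSub A k.val :=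
        le_iSup (fun k : Fin (h + 1) => tauSub A k.val) 0
      have := Submodule.orthogonal_le hle (projPerp_mem _ x)
      rwa [tauSub_orthogonal, lrfS_zero] at this
    have hfd : FiniteDimensional ℂ P.range := Submodule.finiteDimensional_of_le hP
    have hr : (lrfS A (h + 1)).range = P.range.map
        ((projPerp (⨆ j : Fin (h + 1), zetaSub A j.val) * lrfA A (h + 1) 1 : H →L[ℂ] H) :
          H →ₗ[ℂ] H) := by
      rw [lrfS_succ]
      exact LinearMap.range_comp _ _
    rw [hr]
    exact Submodule.closed_of_finiteDimensional _

variable {A}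

/-- The common kernel of `S_0, …, S_n`. -/
def commonKer (A : ℕ → H →L[ℂ] H) (n : ℕ) : Submodule ℂ H :=
  ⨅ j : Fin (n + 1), (lrfS A j.val).ker

theorem mem_commonKer {n : ℕ} {x : H} : x ∈ commonKer A n ↔ ∀ j ≤ n, lrfS A j x = 0 := by
  rw [commonKer, Submodule.mem_iInf]
  exact ⟨fun h j hj => h ⟨j, Nat.lt_succ_of_le hj⟩, fun h j => h j.val (Nat.le_of_lt_succ j.2)⟩

/-! ### Generalized inverses of the `S_h` and the orthogonal blocks -/

theorem isGenInv_lrfS (hcl : ∀ j, IsClosed ((lrfS A j).range : Set H)) (j : ℕ) :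
    IsGenInv (lrfS A j) (genInv (lrfS A j)) := genInv_spec (hcl j)

theorem lrfS_genInv_of_ne (hcl : ∀ j, IsClosed ((lrfS A j).range : Set H)) {i j : ℕ}
    (hij : i ≠ j) (x : H) : lrfS A j (genInv (lrfS A i) x) = 0 :=
  lrfS_apply_eq_zero_of_mem_tauSub A hij ((isGenInv_lrfS hcl i).apply_mem x)

/-- Applying `S_h⁺` turns a relation modulo `𝒵_h` into an equation. -/
theorem genInv_apply_of_mem_iSup (hcl : ∀ j, IsClosed ((lrfS A j).range : Set H)) {h : ℕ} {z : H}
    (hz : z ∈ ⨆ j : Fin h, zetaSub A j.val) : genInv (lrfS A h) z = 0 := by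
  refine (isGenInv_lrfS hcl h).apply_eq_zero ?_
  have hle : (⨆ j : Fin h, zetaSub A j.val) ≤ (lrfS A h).rangeᗮ := by
    refine iSup_le fun j => ?_
    exact Submodule.isOrtho_iff_le.1 (zetaSub_isOrtho A j.2.ne)
  exact hle hz

theorem sub_sum_genInv_mem_ker (hcl : ∀ j, IsClosed ((lrfS A j).range : Set H)) (n : ℕ) (x : H)
    (i : Fin n) :
    lrfS A i.val (x - ∑ j : Fin n, genInv (lrfS A j.val) (lrfS A j.val x)) = 0 := by
  rw [map_sub, map_sum, Finset.sum_eq_single i, (isGenInv_lrfS hcl i).apply_left, sub_self]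
  · intro j _ hj
    exact lrfS_genInv_of_ne hcl (fun h => hj (Fin.ext h)) _
  · simp

/-- The `S_j⁺ S_j` are projections onto the mutually orthogonal `τ_j`, so their sum projects onto
`𝒯_n`. -/
theorem projPerp_tauSub_apply (hcl : ∀ j, IsClosed ((lrfS A j).range : Set H)) (n : ℕ) (x : H) :
    projPerp (⨆ j : Fin n, tauSub A j.val) x =
      x - ∑ j : Fin n, genInv (lrfS A j.val) (lrfS A j.val x) := by
  refine projPerp_eq _ (Submodule.sum_mem _ fun j _ =>
    Submodule.mem_iSup_of_mem j ((isGenInv_lrfS hcl j).apply_mem _)) ?_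
  rw [← Submodule.iInf_orthogonal, Submodule.mem_iInf]
  intro i
  rw [tauSub_orthogonal]
  exact sub_sum_genInv_mem_ker hcl n x i

theorem sub_projPerp_zetaSub_mem (hcl : ∀ j, IsClosed ((lrfS A j).range : Set H)) (n : ℕ)
    (x : H) :
    x - projPerp (⨆ j : Fin n, zetaSub A j.val) x ∈ ⨆ j : Fin n, zetaSub A j.val := by
  have hmem : ∑ j : Fin n, lrfS A j.val (genInv (lrfS A j.val) x) ∈
      ⨆ j : Fin n, zetaSub A j.val :=
    Submodule.sum_mem _ fun j _ => Submodule.mem_iSup_of_mem j ⟨_, rfl⟩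
  rw [projPerp_eq _ hmem, sub_sub_cancel]
  · exact hmem
  rw [← Submodule.iInf_orthogonal, Submodule.mem_iInf]
  intro i
  rw [← Finset.add_sum_erase _ _ (Finset.mem_univ i), ← sub_sub]
  refine Submodule.sub_mem _ ((isGenInv_lrfS hcl i).sub_mem_orthogonal x)
    (Submodule.sum_mem _ fun j hj => ?_)
  exact Submodule.isOrtho_iff_le.1
    (zetaSub_isOrtho A fun h => Finset.ne_of_mem_erase hj (Fin.ext h)) ⟨_, rfl⟩

/-! ### Jordan chains -/

/-- The sum `∑_{k=1}^m A_{h+1,k} x_{m-k}`. -/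
def chainSum (A : ℕ → H →L[ℂ] H) (x : ℕ → H) (h m : ℕ) : H :=
  ∑ k ∈ Finset.range m, lrfA A (h + 1) (k + 1) (x (m - 1 - k))

theorem chainSum_congr {x y : ℕ → H} {m : ℕ} (hxy : ∀ i < m, x i = y i) (h : ℕ) :
    chainSum A x h m = chainSum A y h m := by
  refine Finset.sum_congr rfl fun k hk => ?_
  rw [Finset.mem_range] at hk
  rw [hxy _ (by omega)]

theorem chainSum_zero (x : ℕ → H) (h : ℕ) : chainSum A x h 0 = 0 := by simp [chainSum]

/-- The recursion step: modulo `𝒵_{h+1}`, the sum at stage `h` of length `m + 1` equals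
`S_{h+1} x_m` plus the sum at stage `h + 1` of length `m`. -/
theorem chainSum_succ_sub_mem (hcl : ∀ j, IsClosed ((lrfS A j).range : Set H)) {x : ℕ → H}
    {h m : ℕ}
    (hx : ∀ j ≤ h, genInv (lrfS A j) (lrfS A j (x m)) = -genInv (lrfS A j) (chainSum A x j m)) :
    chainSum A x h (m + 1) - (lrfS A (h + 1) (x m) + chainSum A x (h + 1) m) ∈
      ⨆ j : Fin (h + 1), zetaSub A j.val := by
  have h1 : chainSum A x h (m + 1) = lrfA A (h + 1) 1 (x m) +
      ∑ k ∈ Finset.range m, lrfA A (h + 1) (k + 2) (x (m - 1 - k)) := by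
    rw [chainSum, Finset.sum_range_succ', add_comm]
    congr 1
    refine Finset.sum_congr rfl fun k _ => ?_
    rw [show m + 1 - 1 - (k + 1) = m - 1 - k by omega]
  have h2 : chainSum A x (h + 1) m =
      ∑ k ∈ Finset.range m, lrfA A (h + 1) (k + 2) (x (m - 1 - k)) +
        lrfA A (h + 1) 1 (∑ j : Fin (h + 1), genInv (lrfS A j.val) (lrfS A j.val (x m))) := by
    -- By `hx`, the correction terms in `A_{h+2,k}` add up to `A_{h+1,1}` applied to the
    -- `𝒯_{h+1}`-component of `x m`; the remaining component is what `S_{h+1}` sees.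
    have h3 : ∑ j : Fin (h + 1), genInv (lrfS A j.val) (lrfS A j.val (x m)) =
        -∑ k ∈ Finset.range m, ∑ j : Fin (h + 1),
          genInv (lrfS A j.val) (lrfA A (j.val + 1) (k + 1) (x (m - 1 - k))) := by
      rw [Finset.sum_comm, ← Finset.sum_neg_distrib]
      refine Finset.sum_congr rfl fun j _ => ?_
      rw [hx j (Nat.le_of_lt_succ j.2), chainSum, map_sum]
    rw [h3, map_neg, map_sum, ← sub_eq_add_neg, ← Finset.sum_sub_distrib, chainSum]
    refine Finset.sum_congr rfl fun k _ => ?_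
    rw [lrfA_succ_succ]
    simp
  have h4 : lrfS A (h + 1) (x m) = projPerp (⨆ j : Fin (h + 1), zetaSub A j.val)
      (lrfA A (h + 1) 1 (x m - ∑ j : Fin (h + 1), genInv (lrfS A j.val) (lrfS A j.val (x m)))) := by
    rw [← projPerp_tauSub_apply hcl, lrfS_succ]
    rfl
  have h5 := sub_projPerp_zetaSub_mem hcl (h + 1)
    (lrfA A (h + 1) 1 (x m - ∑ j : Fin (h + 1), genInv (lrfS A j.val) (lrfS A j.val (x m))))
  rw [← h4] at h5
  rw [h1, h2]
  convert h5 using 1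
  rw [map_sub]
  abel

/-- `x` is a Jordan chain of length `n + 1`: the first `n + 1` coefficients of
`(∑ A_i wⁱ)(∑ x_i wⁱ)` vanish. -/
def IsJordanChain (A : ℕ → H →L[ℂ] H) (n : ℕ) (x : ℕ → H) : Prop :=
  ∀ m ≤ n, A 0 (x m) + chainSum A x 0 m = 0

/-- Elimination, by induction on `h`: the relations at stages `≤ h` determine `S_j⁺ S_j x_m`, and
`chainSum_succ_sub_mem` then trades length `m + 1` at stage `h` for length `m` at stage `h + 1`. -/
theorem IsJordanChain.lrfS_add_chainSum_mem (hcl : ∀ j, IsClosed ((lrfS A j).range : Set H))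
    {n : ℕ} {x : ℕ → H} (hx : IsJordanChain A n x) (h : ℕ) :
    ∀ m, h + m ≤ n → lrfS A h (x m) + chainSum A x h m ∈ ⨆ j : Fin h, zetaSub A j.val := by
  induction h using Nat.strong_induction_on with
  | _ h ih =>
    cases h with
    | zero =>
      intro m hm
      rw [lrfS_zero, hx m (by omega)]
      exact Submodule.zero_mem _
    | succ h =>
      intro m hm
      have key := chainSum_succ_sub_mem hcl (x := x) (h := h) (m := m) fun j hj => by
        have := genInv_apply_of_mem_iSup hcl (ih j (by omega) m (by omega))
        rwa [map_add, add_eq_zero_iff_eq_neg] at this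
      have hle : (⨆ j : Fin h, zetaSub A j.val) ≤ ⨆ j : Fin (h + 1), zetaSub A j.val :=
        iSup_le fun j => le_iSup (fun j : Fin (h + 1) => zetaSub A j.val) j.castSucc
      have h1 := hle (ih h (by omega) (m + 1) (by omega))
      have h2 : lrfS A h (x (m + 1)) ∈ ⨆ j : Fin (h + 1), zetaSub A j.val :=
        Submodule.mem_iSup_of_mem (Fin.last h) ⟨_, rfl⟩
      have := Submodule.sub_mem _ (Submodule.sub_mem _ h1 h2) key
      convert this using 1
      abel

theorem IsJordanChain.head_mem_commonKer (hcl : ∀ j, IsClosed ((lrfS A j).range : Set H))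
    {n : ℕ} {x : ℕ → H} (hx : IsJordanChain A n x) : x 0 ∈ commonKer A n := by
  rw [mem_commonKer]
  intro j hj
  have := genInv_apply_of_mem_iSup hcl (hx.lrfS_add_chainSum_mem hcl j 0 (by omega))
  rw [chainSum_zero, add_zero] at this
  rw [← (isGenInv_lrfS hcl j).apply_left, this, map_zero]

/-- Back substitution: each new coefficient is prescribed on every relevant `τ_h` separately, which
is consistent because the `τ_h` are orthogonal. -/
theorem exists_chain_of_mem_commonKer (hcl : ∀ j, IsClosed ((lrfS A j).range : Set H)) {n : ℕ}
    {a : H} (ha : a ∈ commonKer A n) (l : ℕ) :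
    ∃ x : ℕ → H, x 0 = a ∧ ∀ i ≤ l, ∀ h, h + i ≤ n →
      genInv (lrfS A h) (lrfS A h (x i)) = -genInv (lrfS A h) (chainSum A x h i) := by
  induction l with
  | zero =>
    refine ⟨fun _ => a, rfl, fun i hi h hh => ?_⟩
    obtain rfl : i = 0 := by omega
    rw [chainSum_zero, mem_commonKer.1 ha h (by omega)]
    simp
  | succ l ih =>
    obtain ⟨x, hx0, hx⟩ := ih
    refine ⟨Function.update x (l + 1)
      -- The range consists of the stages `j` with `j + (l + 1) ≤ n`; applying `S_h` keeps only the
      -- term `j = h`.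
      (-∑ j ∈ Finset.range (n - l), genInv (lrfS A j) (chainSum A x j (l + 1))), ?_, ?_⟩
    · rw [Function.update_of_ne (by omega), hx0]
    · intro i hi h hh
      rw [chainSum_congr (y := x) fun j hj => Function.update_of_ne (by omega) _ _]
      rcases Nat.lt_or_ge i (l + 1) with hi' | hi'
      · rw [Function.update_of_ne (by omega)]
        exact hx i (by omega) h hh
      · obtain rfl : i = l + 1 := by omega
        rw [Function.update_self, map_neg, map_neg, map_sum, Finset.sum_eq_single h,
          (isGenInv_lrfS hcl h).apply_right]
        · intro j _ hj
          exact lrfS_genInv_of_ne hcl hj _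
        · intro hn
          exact absurd (Finset.mem_range.2 (by omega)) hn

theorem exists_isJordanChain (hcl : ∀ j, IsClosed ((lrfS A j).range : Set H)) {n : ℕ}
    {a : H} (ha : a ∈ commonKer A n) : ∃ x, x 0 = a ∧ IsJordanChain A n x := by
  obtain ⟨x, hx0, hx⟩ := exists_chain_of_mem_commonKer hcl ha n
  refine ⟨x, hx0, ?_⟩
  -- Here the induction is on `m`, for all `h` at once: stage `h + 1` at length `m` puts the
  -- stage-`h` sum of length `m + 1` in `𝒵_h ⊕ ζ_h`, and `x (m + 1)` was chosen to cancel the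
  -- `ζ_h`-part.
  have key : ∀ m h, h + m ≤ n →
      lrfS A h (x m) + chainSum A x h m ∈ ⨆ j : Fin h, zetaSub A j.val := by
    intro m
    induction m with
    | zero =>
      intro h hh
      rw [chainSum_zero, hx0, mem_commonKer.1 ha h (by omega), add_zero]
      exact Submodule.zero_mem _
    | succ m ih =>
      intro h hh
      have h1 := Submodule.add_mem _ (chainSum_succ_sub_mem hcl (x := x) (h := h) (m := m)
        fun j hj => hx m (by omega) j (by omega)) (ih (h + 1) (by omega))
      rw [sub_add_cancel] at h1
      have hle : (⨆ j : Fin (h + 1), zetaSub A j.val) ≤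
          (⨆ j : Fin h, zetaSub A j.val) ⊔ zetaSub A h := by
        refine iSup_le fun j => ?_
        rcases Nat.lt_succ_iff_lt_or_eq.1 j.2 with hj | hj
        · exact le_sup_of_le_left (le_iSup (fun j : Fin h => zetaSub A j.val) ⟨j, hj⟩)
        · rw [hj]
          exact le_sup_right
      obtain ⟨z, hz, _, ⟨v, rfl⟩, hzv⟩ := Submodule.mem_sup.1 (hle h1)
      have hzv' : z + lrfS A h v = chainSum A x h (m + 1) := hzv
      have h2 : lrfS A h (x (m + 1)) = -lrfS A h v := by
        rw [← (isGenInv_lrfS hcl h).apply_left (x (m + 1)), hx (m + 1) (by omega) h hh, ← hzv',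
          map_add, genInv_apply_of_mem_iSup hcl hz, zero_add, map_neg,
          (isGenInv_lrfS hcl h).apply_left]
      rw [h2, ← hzv', add_comm z, neg_add_cancel_left]
      exact hz
  intro m hm
  have := key m 0 (by omega)
  rwa [iSup_of_empty, Submodule.mem_bot, lrfS_zero] at this

theorem mem_commonKer_iff (hcl : ∀ j, IsClosed ((lrfS A j).range : Set H)) {n : ℕ} {a : H} :
    a ∈ commonKer A n ↔ ∃ x, x 0 = a ∧ IsJordanChain A n x := by
  refine ⟨exists_isJordanChain hcl, ?_⟩
  rintro ⟨x, rfl, hx⟩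
  exact hx.head_mem_commonKer hcl

/-! ### The pole condition -/

theorem orthogonal_iSup_tauSub (n : ℕ) :
    (⨆ j : Fin (n + 1), tauSub A j.val)ᗮ = commonKer A n := by
  rw [← Submodule.iInf_orthogonal, commonKer]
  simp_rw [tauSub_orthogonal]

theorem isInternal_tauSub_iff (hcl : ∀ j, IsClosed ((lrfS A j).range : Set H)) (n : ℕ) :
    DirectSum.IsInternal (fun h : Fin (n + 1) => tauSub A h.val) ↔ commonKer A n = ⊥ := by
  rw [← orthogonal_iSup_tauSub]
  constructor
  · intro h
    rw [h.submodule_iSup_eq_top, Submodule.top_orthogonal_eq_bot]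
  · intro h
    rw [DirectSum.isInternal_submodule_iff_iSupIndep_and_iSup_eq_top]
    refine ⟨?_, ?_⟩
    · refine (OrthogonalFamily.of_pairwise (𝕜 := ℂ) fun i j hij => ?_).independent
      exact tauSub_isOrtho A fun h => hij (Fin.ext h)
    · rw [eq_top_iff]
      intro x _
      have h1 := projPerp_mem (⨆ j : Fin (n + 1), tauSub A j.val) x
      rw [h, Submodule.mem_bot, projPerp_tauSub_apply hcl, sub_eq_zero] at h1
      rw [h1]
      exact Submodule.sum_mem _ fun j _ =>
        Submodule.mem_iSup_of_mem j ((isGenInv_lrfS hcl j).apply_mem _)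

/-- By orthogonality `τ_{n+1}` lies in the common kernel of `S_0, …, S_n`, so it vanishes if that
kernel does. Conversely, `τ_{n+1} = 0` means `S_{n+1} = 0`, so passing from `n` to `n + 1` leaves
the common kernel unchanged. -/
theorem poleDecomposition_iff (hcl : ∀ j, IsClosed ((lrfS A j).range : Set H)) (n : ℕ) :
    (DirectSum.IsInternal (fun h : Fin (n + 2) => tauSub A h.val) ∧
      (∀ i j : Fin (n + 2), i ≠ j → tauSub A i.val ⟂ tauSub A j.val) ∧
      tauSub A (n + 1) ≠ ⊥) ↔ commonKer A (n + 1) = ⊥ ∧ commonKer A n ≠ ⊥ := by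
  rw [isInternal_tauSub_iff hcl]
  refine and_congr_right fun hbot => ?_
  constructor
  · rintro ⟨-, htau⟩ hn
    obtain ⟨y, hy, hy0⟩ := Submodule.exists_mem_ne_zero_of_ne_bot htau
    have : y ∈ commonKer A n := mem_commonKer.2 fun j hj =>
      lrfS_apply_eq_zero_of_mem_tauSub A (by omega) hy
    rw [hn, Submodule.mem_bot] at this
    exact hy0 this
  · intro hn
    refine ⟨fun i j hij => tauSub_isOrtho A fun h => hij (Fin.ext h), fun htau => hn ?_⟩
    rw [eq_bot_iff, ← hbot]
    intro y hy
    have hker : (lrfS A (n + 1)).ker = ⊤ := by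
      rw [← tauSub_orthogonal, htau, Submodule.bot_orthogonal_eq_top]
    rw [mem_commonKer] at hy ⊢
    intro j hj
    rcases Nat.le_succ_iff.1 hj with h | rfl
    · exact hy j h
    · have : y ∈ (lrfS A (n + 1)).ker := by rw [hker]; exact Submodule.mem_top
      exact this

end Recursion

/-! ### Linear pencils -/

section Pencil

theorem chainSum_pencil {A : ℕ → H →L[ℂ] H} (hA : ∀ n, 2 ≤ n → A n = 0) (x : ℕ → H) (m : ℕ) :
    chainSum A x 0 (m + 1) = A 1 (x m) := by
  rw [chainSum, Finset.sum_eq_single 0]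
  · rw [lrfA_one]
    simp
  · intro k _ hk
    rw [lrfA_one, hA _ (by omega)]
    rfl
  · simp

theorem isJordanChain_pencil_iff {A : ℕ → H →L[ℂ] H} (hA : ∀ n, 2 ≤ n → A n = 0) {n : ℕ}
    {x : ℕ → H} : IsJordanChain A n x ↔
      A 0 (x 0) = 0 ∧ ∀ m < n, A 0 (x (m + 1)) + A 1 (x m) = 0 := by
  constructor
  · intro h
    refine ⟨by simpa [chainSum_zero] using h 0 (by omega), fun m hm => ?_⟩
    rw [← chainSum_pencil hA]
    exact h (m + 1) hm
  · rintro ⟨h0, h1⟩ m hm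
    cases m with
    | zero => rw [chainSum_zero, h0, add_zero]
    | succ m =>
      rw [chainSum_pencil hA]
      exact h1 m hm

/-- For the pencil `(1 - T) + w T`, the common kernel of `S_0, …, S_n` is
`Ker (1 - T) ∩ Im (1 - T)ⁿ`. -/
theorem mem_commonKer_pencil_iff {A : ℕ → H →L[ℂ] H} {T : H →L[ℂ] H} (h0 : A 0 = 1 - T)
    (h1 : A 1 = T) (hA : ∀ n, 2 ≤ n → A n = 0)
    (hcl : ∀ j, IsClosed ((lrfS A j).range : Set H)) (n : ℕ) (a : H) :
    a ∈ commonKer A n ↔ (1 - T) a = 0 ∧ ∃ y, ((1 - T) ^ n) y = a := by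
  rw [mem_commonKer_iff hcl]
  simp_rw [isJordanChain_pencil_iff hA, h0, h1]
  have hcomm : Commute (1 - T) T := (Commute.one_left T).sub_left (Commute.refl T)
  constructor
  · rintro ⟨x, rfl, hx0, hx⟩
    refine ⟨hx0, ?_⟩
    have hT : T (x 0) = x 0 := by
      have : x 0 - T (x 0) = 0 := hx0
      exact (sub_eq_zero.1 this).symm
    -- The chain equation is `D x_{m+1} = -T x_m`, and `T` fixes `x 0`.
    have key : ∀ m ≤ n, ((1 - T) ^ m) (x m) = (-1 : ℂ) ^ m • x 0 := by
      intro m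
      induction m with
      | zero => simp
      | succ m ih =>
        intro hm
        have e1 : (1 - T) (x (m + 1)) = -T (x m) := eq_neg_of_add_eq_zero_left (hx m hm)
        have e2 : ((1 - T) ^ m) (T (x m)) = T (((1 - T) ^ m) (x m)) :=
          DFunLike.congr_fun (hcomm.pow_left m).eq (x m)
        rw [pow_succ]
        change ((1 - T) ^ m) ((1 - T) (x (m + 1))) = _
        rw [e1, map_neg, e2, ih (by omega), map_smul, hT, pow_succ]
        simp
    refine ⟨(-1 : ℂ) ^ n • x n, ?_⟩
    rw [map_smul, key n le_rfl, smul_smul, ← mul_pow]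
    simp
  · rintro ⟨ha, y, rfl⟩
    -- The chain is `x_i = (-T)^i D^(n-i) y`; only `i ≤ n` matters, so truncated subtraction is
    -- harmless.
    refine ⟨fun i => (-1 : ℂ) ^ i • (T ^ i) (((1 - T) ^ (n - i)) y), by simp, ?_, fun m hm => ?_⟩
    · simpa using ha
    · have e1 : (1 - T) ((T ^ (m + 1)) (((1 - T) ^ (n - (m + 1))) y)) =
          T ((T ^ m) (((1 - T) ^ (n - m)) y)) := by
        rw [show n - m = (n - (m + 1)) + 1 by omega, pow_succ' (1 - T), pow_succ' T]
        have := DFunLike.congr_fun (hcomm.pow_right (m + 1)).eq (((1 - T) ^ (n - (m + 1))) y)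
        rw [pow_succ' T] at this
        exact this
      rw [map_smul, map_smul, e1, pow_succ]
      simp

theorem commonKer_pencil_eq_bot_iff {A : ℕ → H →L[ℂ] H} {T : H →L[ℂ] H} (h0 : A 0 = 1 - T)
    (h1 : A 1 = T) (hA : ∀ n, 2 ≤ n → A n = 0)
    (hcl : ∀ j, IsClosed ((lrfS A j).range : Set H)) (n : ℕ) :
    commonKer A n = ⊥ ↔ ∀ y, ((1 - T) ^ (n + 1)) y = 0 → ((1 - T) ^ n) y = 0 := by
  rw [Submodule.eq_bot_iff]
  simp_rw [mem_commonKer_pencil_iff h0 h1 hA hcl]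
  constructor
  · intro h y hy
    rw [pow_succ'] at hy
    exact h _ ⟨hy, y, rfl⟩
  · rintro h _ ⟨hy, y, rfl⟩
    refine h y ?_
    rw [pow_succ']
    exact hy

end Pencil

/-! ### Powers of an operator with closed range and finite-dimensional kernel -/

section Powers

variable {D : H →L[ℂ] H}

/-- An operator with closed range and finite-dimensional kernel maps closed subspaces to closed
subspaces. -/
theorem isClosed_map_of_isClosed_range (hD : IsClosed (D.range : Set H))
    [FiniteDimensional ℂ D.ker] {Y : Submodule ℂ H} (hY : IsClosed (Y : Set H)) :
    IsClosed (Y.map (D : H →ₗ[ℂ] H) : Set H) := by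
  obtain ⟨X, hX⟩ := exists_isGenInv hD
  have hsup : IsClosed ((Y ⊔ D.ker : Submodule ℂ H) : Set H) :=
    Submodule.isClosed_sup_finiteDimensional _ _ hY
  -- Since `X D y` and `y` differ by an element of `Ker D`, membership in `D(Y)` can be tested by
  -- the closed condition `X u ∈ Y + Ker D`.
  have heq : (Y.map (D : H →ₗ[ℂ] H) : Set H) =
      (D.range : Set H) ∩ X ⁻¹' ((Y ⊔ D.ker : Submodule ℂ H) : Set H) := by
    ext u
    constructor
    · rintro ⟨y, hy, rfl⟩
      refine ⟨⟨y, rfl⟩, ?_⟩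
      change X (D y) ∈ Y ⊔ D.ker
      rw [← sub_sub_cancel y (X (D y))]
      exact Submodule.sub_mem _ (Submodule.mem_sup_left hy)
        (Submodule.mem_sup_right (hX.sub_mem_ker y))
    · rintro ⟨⟨v, rfl⟩, hu⟩
      obtain ⟨y, hy, k, hk, hyk⟩ := Submodule.mem_sup.1 hu
      refine ⟨y, hy, ?_⟩
      have hk' : D k = 0 := hk
      have hyk' : y + k = X (D v) := hyk
      have := congrArg D hyk'
      rw [map_add, hk', add_zero, hX.apply_left] at this
      exact this
  rw [heq]
  exact hD.inter (hsup.preimage X.continuous)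

theorem range_pow_succ_eq_map (n : ℕ) :
    (D ^ (n + 1)).range = (D ^ n).range.map (D : H →ₗ[ℂ] H) := by
  rw [pow_succ']
  exact LinearMap.range_comp _ _

theorem isClosed_range_pow (hD : IsClosed (D.range : Set H)) [FiniteDimensional ℂ D.ker] (n : ℕ) :
    IsClosed ((D ^ n).range : Set H) := by
  induction n with
  | zero =>
    have : (D ^ 0).range = ⊤ := by
      rw [eq_top_iff]
      exact fun x _ => ⟨x, rfl⟩
    rw [this]
    exact isClosed_univ
  | succ n ih =>
    rw [range_pow_succ_eq_map]
    exact isClosed_map_of_isClosed_range hD ih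

/-- If `Ker Dⁿ⁺¹ = Ker Dⁿ`, then `D` is bounded below on `Im Dⁿ`. -/
theorem exists_bounded_below_on_range_pow (hD : IsClosed (D.range : Set H))
    [FiniteDimensional ℂ D.ker] {n : ℕ} (hn : ∀ y, (D ^ (n + 1)) y = 0 → (D ^ n) y = 0) :
    ∃ c > (0 : ℝ), ∀ u ∈ (D ^ n).range, c * ‖u‖ ≤ ‖D u‖ := by
  have : CompleteSpace (D ^ n).range := (isClosed_range_pow hD n).completeSpace_coe
  set f : (D ^ n).range →L[ℂ] H := D ∘L (D ^ n).range.subtypeL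
  have hinj : Function.Injective f := by
    rw [injective_iff_map_eq_zero]
    rintro ⟨_, y, rfl⟩ h
    refine Subtype.ext (hn y ?_)
    rw [pow_succ']
    exact h
  have hrange : Set.range f = ((D ^ (n + 1)).range : Set H) := by
    rw [range_pow_succ_eq_map]
    ext u
    constructor
    · rintro ⟨y, rfl⟩
      exact ⟨y, y.2, rfl⟩
    · rintro ⟨y, hy, rfl⟩
      exact ⟨⟨y, hy⟩, rfl⟩
  obtain ⟨K, hK⟩ := f.antilipschitz_of_injective_of_isClosed_range hinj
    (hrange ▸ isClosed_range_pow hD (n + 1))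
  -- `K + 1` keeps the constant positive when `K = 0`.
  refine ⟨((K : ℝ) + 1)⁻¹, by positivity, fun u hu => ?_⟩
  have h1 := hK.le_mul_dist ⟨u, hu⟩ 0
  rw [map_zero, dist_zero_right, dist_zero_right] at h1
  have h2 : ‖u‖ ≤ K * ‖D u‖ := h1
  rw [inv_mul_le_iff₀ (by positivity)]
  nlinarith [norm_nonneg (D u)]

end Powers

/-! ### The Riesz projection -/

section Riesz

variable {T : H →L[ℂ] H} {r : ℝ}

theorem IsIsolatingRadius.mem_resolventSet {μ : ℂ} (hr : IsIsolatingRadius T μ r) {w : ℂ}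
    (hw : w ∈ Metric.closedBall μ r) (hne : w ≠ μ) : w ∈ resolventSet ℂ T := by
  by_contra h
  have : w ∈ Metric.closedBall μ r ∩ spectrum ℂ T := ⟨hw, h⟩
  rw [hr.2] at this
  exact hne this

theorem resolvent_apply_sub {w : ℂ} (hw : w ∈ resolventSet ℂ T) (x : H) :
    resolvent T w (w • x - T x) = x := by
  have := Ring.inverse_mul_cancel _ (spectrum.mem_resolventSet_iff.1 hw)
  have := DFunLike.congr_fun this x
  rw [Algebra.algebraMap_eq_smul_one] at this
  rw [resolvent, Algebra.algebraMap_eq_smul_one]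
  exact this

theorem sub_one_smul_resolvent_apply {w : ℂ} (hw : w ∈ resolventSet ℂ T) (x : H) :
    (w - 1) • resolvent T w x = x - resolvent T w ((1 - T) x) := by
  have h : w • x - T x = (w - 1) • x + (1 - T) x := by
    change _ = (w - 1) • x + (x - T x)
    rw [sub_smul, one_smul]
    abel
  have h1 := resolvent_apply_sub hw x
  rw [h, map_add, map_smul] at h1
  exact eq_sub_of_add_eq h1

theorem sub_apply_resolvent {w : ℂ} (hw : w ∈ resolventSet ℂ T) (x : H) :
    w • resolvent T w x - T (resolvent T w x) = x := by
  have := Ring.mul_inverse_cancel _ (spectrum.mem_resolventSet_iff.1 hw)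
  have := DFunLike.congr_fun this x
  rw [Algebra.algebraMap_eq_smul_one] at this
  rw [resolvent, Algebra.algebraMap_eq_smul_one]
  exact this

theorem differentiableAt_resolvent_apply {w : ℂ} (hw : w ∈ resolventSet ℂ T) (x : H) :
    DifferentiableAt ℂ (fun w => resolvent T w x) w :=
  (spectrum.hasDerivAt_resolvent_const_left hw).differentiableAt.clm_apply
    (differentiableAt_const x)

theorem IsIsolatingRadius.sphere_subset {μ : ℂ} (hr : IsIsolatingRadius T μ r) :
    Metric.sphere μ r ⊆ resolventSet ℂ T := by
  intro w hw
  refine hr.mem_resolventSet (Metric.sphere_subset_closedBall hw) ?_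
  rintro rfl
  rw [Metric.mem_sphere, dist_self] at hw
  exact hr.1.ne hw

theorem IsIsolatingRadius.continuousOn_resolvent_apply {μ : ℂ} (hr : IsIsolatingRadius T μ r)
    (x : H) : ContinuousOn (fun w => resolvent T w x) (Metric.sphere μ r) := by
  intro w hw
  have h := differentiableAt_resolvent_apply (hr.sphere_subset hw) x
  exact h.continuousAt.continuousWithinAt

theorem rieszProjection_apply {μ : ℂ} (hr : IsIsolatingRadius T μ r) (x : H) :
    rieszProjection T μ r x =
      (2 * Real.pi * Complex.I : ℂ)⁻¹ • circleIntegral (fun w => resolvent T w x) μ r := by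
  have hcont : ContinuousOn (fun w => resolvent T w) (Metric.sphere μ r) := fun w hw =>
    (spectrum.hasDerivAt_resolvent_const_left
      (hr.sphere_subset hw)).continuousAt.continuousWithinAt
  have hint : CircleIntegrable (fun w => resolvent T w) μ r := hcont.circleIntegrable hr.1.le
  rw [rieszProjection]
  change (2 * Real.pi * Complex.I : ℂ)⁻¹ • (circleIntegral (fun w => resolvent T w) μ r) x = _
  congr 1
  have := (ContinuousLinearMap.apply ℂ H x).intervalIntegral_comp_comm hint.out
  rw [circleIntegral, circleIntegral]
  exact this.symm

/-- The Riesz projection is the identity on `Ker (1 - T)ⁿ`. -/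
theorem rieszProjection_apply_of_pow_eq_zero (hr : IsIsolatingRadius T 1 r) (n : ℕ) {x : H}
    (hx : ((1 - T) ^ n) x = 0) : rieszProjection T 1 r x = x := by
  -- With `R` the resolvent, `(w-1)^(-k) R x = (w-1)^(-k-1) x - (w-1)^(-k-1) R D x`. Replacing `x`
  -- by `D x` raises the pole order, so the induction must cover all `k`; only `k = 0` leaves a
  -- residue.
  have key : ∀ n : ℕ, ∀ x : H, ((1 - T) ^ n) x = 0 → ∀ k : ℕ,
      circleIntegral (fun w => (w - 1) ^ (-(k : ℤ)) • resolvent T w x) 1 r =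
        if k = 0 then (2 * Real.pi * Complex.I : ℂ) • x else 0 := by
    intro n
    induction n with
    | zero =>
      intro x hx k
      have : x = 0 := hx
      simp [this, circleIntegral]
    | succ n ih =>
      intro x hx k
      have hx' : ((1 - T) ^ n) ((1 - T) x) = 0 := by
        rw [pow_succ] at hx
        exact hx
      have h1 := ih _ hx' (k + 1)
      rw [if_neg (by omega)] at h1
      have hne : ∀ w ∈ Metric.sphere (1 : ℂ) r, w - 1 ≠ 0 := fun w hw h => by
        rw [sub_eq_zero] at h
        rw [h, Metric.mem_sphere, dist_self] at hw
        exact hr.1.ne hw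
      have hcz : ∀ m : ℤ, ContinuousOn (fun w : ℂ => (w - 1) ^ m) (Metric.sphere 1 r) :=
        fun m => ContinuousOn.zpow₀ (by fun_prop) m fun w hw => Or.inl (hne w hw)
      have h2 : circleIntegral (fun w => (w - 1) ^ (-(k : ℤ)) • resolvent T w x) 1 r =
          circleIntegral (fun w => (w - 1) ^ (-(k : ℤ) - 1) • x -
            (w - 1) ^ (-((k + 1 : ℕ) : ℤ)) • resolvent T w ((1 - T) x)) 1 r := by
        refine circleIntegral.integral_congr hr.1.le fun w hw => ?_
        have h5 : (w - 1 : ℂ) ^ (-(k : ℤ)) = (w - 1) ^ (-(k : ℤ) - 1) * (w - 1) := by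
          rw [← zpow_add_one₀ (hne w hw), sub_add_cancel]
        change (w - 1 : ℂ) ^ (-(k : ℤ)) • resolvent T w x = _
        rw [h5, mul_smul, sub_one_smul_resolvent_apply (hr.sphere_subset hw), smul_sub]
        push_cast
        rw [neg_add']
      rw [h2, circleIntegral.integral_sub, h1, sub_zero, circleIntegral.integral_smul_const]
      · rcases Nat.eq_zero_or_pos k with rfl | hk
        · have h6 := circleIntegral.integral_sub_center_inv (1 : ℂ) hr.1.ne'
          simp [h6]
        · rw [circleIntegral.integral_sub_zpow_of_ne (by omega), zero_smul, if_neg (by omega)]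
      · exact ((hcz _).smul continuousOn_const).circleIntegrable hr.1.le
      · exact ((hcz _).smul (hr.continuousOn_resolvent_apply _)).circleIntegrable hr.1.le
  have h := key n x hx 0
  simp only [Nat.cast_zero, neg_zero, zpow_zero, one_smul, if_true] at h
  rw [rieszProjection_apply hr, h, inv_smul_smul₀ Complex.two_pi_I_ne_zero]

/-- If `1 - T` has closed range, finite-dimensional kernel and ascent at most `n`, the Riesz
projection vanishes on `Im (1 - T)ⁿ`. -/
theorem rieszProjection_apply_pow_eq_zero (hr : IsIsolatingRadius T 1 r)
    (hD : IsClosed ((1 - T).range : Set H)) [FiniteDimensional ℂ (1 - T).ker] {n : ℕ}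
    (hn : ∀ y, ((1 - T) ^ (n + 1)) y = 0 → ((1 - T) ^ n) y = 0) (x : H) :
    rieszProjection T 1 r (((1 - T) ^ n) x) = 0 := by
  obtain ⟨c, hc, hbelow⟩ := exists_bounded_below_on_range_pow hD hn
  set y := ((1 - T) ^ n) x with hy
  set f : ℂ → H := fun w => resolvent T w y with hf
  have hdiff : DifferentiableOn ℂ f (Metric.closedBall 1 r \ {1}) := fun w hw =>
    (differentiableAt_resolvent_apply
      (hr.mem_resolventSet hw.1 hw.2) y).differentiableWithinAt
  -- `f w` stays in `Im D^n`, and `D (f w) = y - (w - 1) f w`; for `|w - 1| ≤ c / 2` the last term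
  -- is absorbed by the lower bound `c ‖f w‖`.
  have hbound : ∀ w ∈ Metric.closedBall (1 : ℂ) r, w ≠ 1 → dist w 1 ≤ c / 2 →
      ‖f w‖ ≤ 2 * ‖y‖ / c := by
    intro w hw hne hwc
    have hres := hr.mem_resolventSet hw hne
    have hcomm : Commute (resolvent T w) ((1 - T) ^ n) :=
      (((Commute.one_left _).sub_left (commute_resolvent T w)).pow_left n).symm
    have hmem : f w ∈ ((1 - T) ^ n).range :=
      ⟨resolvent T w x, (DFunLike.congr_fun hcomm.eq x).symm⟩
    have h1 := hbelow _ hmem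
    have h2 : (1 - T) (f w) = y - (w - 1) • f w := by
      change f w - T (f w) = y - (w - 1) • f w
      have h3 : w • f w - T (f w) = y := sub_apply_resolvent hres y
      rw [← h3, sub_smul, one_smul]
      abel
    have h4 : ‖(1 - T) (f w)‖ ≤ ‖y‖ + c / 2 * ‖f w‖ := by
      rw [h2]
      refine (norm_sub_le _ _).trans ?_
      rw [norm_smul, ← dist_eq_norm]
      gcongr
    rw [le_div_iff₀ hc]
    linarith
  have hnhds : Metric.closedBall (1 : ℂ) r ∈ nhds (1 : ℂ) := Metric.closedBall_mem_nhds _ hr.1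
  have hlittle : (fun w => f w - f 1) =o[nhdsWithin 1 {1}ᶜ] fun w => (w - 1 : ℂ)⁻¹ := by
    refine Filter.IsBoundedUnder.isLittleO_sub_self_inv ⟨2 * ‖y‖ / c + ‖f 1‖, ?_⟩
    rw [Filter.eventually_map]
    filter_upwards [self_mem_nhdsWithin, nhdsWithin_le_nhds hnhds,
      nhdsWithin_le_nhds (Metric.closedBall_mem_nhds (1 : ℂ) (half_pos hc))] with w h1 h2 h3
    exact norm_sub_le_of_le (hbound w h2 h1 h3) le_rfl
  -- Riemann's removable singularity theorem, then Cauchy's theorem; changing `f` at the centre does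
  -- not affect the integral.
  have hupd := Complex.differentiableOn_update_limUnder_of_isLittleO hnhds hdiff hlittle
  have hzero := Complex.circleIntegral_eq_zero_of_differentiable_on_off_countable hr.1.le
    Set.countable_empty hupd.continuousOn fun z hz =>
      hupd.differentiableAt (Metric.closedBall_mem_nhds_of_mem hz.1)
  rw [rieszProjection_apply hr, ← hf]
  have hcongr : ∀ v : H, circleIntegral f 1 r =
      circleIntegral (Function.update f 1 v) 1 r := by
    intro v
    refine circleIntegral.integral_congr hr.1.le fun w hw => ?_
    rw [Function.update_of_ne]
    rintro rfl
    rw [Metric.mem_sphere, dist_self] at hw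
    exact hr.1.ne hw
  rw [hcongr, hzero, smul_zero]

/-! ### Nilpotency on the Riesz subspace and the ascent -/

theorem rieszRestrict_sub_one_pow_apply (T : H →L[ℂ] H) (r : ℝ) (n : ℕ)
    (x : rieszSubspace T 1 r) :
    (((rieszRestrict T 1 r - 1) ^ n) x : H) = (-1 : ℂ) ^ n • ((1 - T) ^ n) (x : H) := by
  induction n with
  | zero => simp
  | succ n ih =>
    rw [pow_succ', pow_succ' (1 - T)]
    change T (((rieszRestrict T 1 r - 1) ^ n) x : H) - (((rieszRestrict T 1 r - 1) ^ n) x : H) =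
      (-1 : ℂ) ^ (n + 1) • (((1 - T) ^ n) (x : H) - T (((1 - T) ^ n) (x : H)))
    rw [ih, map_smul, pow_succ, mul_neg_one, neg_smul, smul_sub, neg_sub]

theorem rieszRestrict_sub_one_pow_eq_zero_iff (T : H →L[ℂ] H) (r : ℝ) (n : ℕ) :
    (rieszRestrict T 1 r - 1) ^ n = 0 ↔ ∀ x ∈ rieszSubspace T 1 r, ((1 - T) ^ n) x = 0 := by
  have h0 : ((-1 : ℂ) ^ n) ≠ 0 := pow_ne_zero _ (by norm_num)
  constructor
  · intro h x hx
    have := rieszRestrict_sub_one_pow_apply T r n ⟨x, hx⟩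
    rw [h] at this
    exact (smul_eq_zero_iff_right h0).1 this.symm
  · intro h
    refine LinearMap.ext fun x => Subtype.ext ?_
    rw [rieszRestrict_sub_one_pow_apply, h x x.2, smul_zero]
    rfl

/-- The Hu–Park condition says that the ascent of `1 - T` is `n + 1`. -/
theorem huParkCondition_succ_iff (hr : IsIsolatingRadius T 1 r)
    (hD : IsClosed ((1 - T).range : Set H)) [FiniteDimensional ℂ (1 - T).ker] (n : ℕ) :
    HuParkCondition T r (n + 1) ↔
      (∀ y, ((1 - T) ^ (n + 2)) y = 0 → ((1 - T) ^ (n + 1)) y = 0) ∧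
        ¬∀ y, ((1 - T) ^ (n + 1)) y = 0 → ((1 - T) ^ n) y = 0 := by
  rw [HuParkCondition, Nat.add_sub_cancel, Ne, rieszRestrict_sub_one_pow_eq_zero_iff,
    rieszRestrict_sub_one_pow_eq_zero_iff]
  have hmem : ∀ (m : ℕ) (y : H), ((1 - T) ^ m) y = 0 → y ∈ rieszSubspace T 1 r := fun m y hy =>
    ⟨y, rieszProjection_apply_of_pow_eq_zero hr m hy⟩
  constructor
  · rintro ⟨h1, h2⟩
    exact ⟨fun y hy => h2 y (hmem _ y hy), fun h => h1 fun x hx => h x (h2 x hx)⟩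
  · rintro ⟨h1, h2⟩
    refine ⟨fun h => h2 fun y hy => h y (hmem _ y hy), ?_⟩
    rintro _ ⟨y, rfl⟩
    -- With `P` the Riesz projection, `D^(n+1) P y = P D^(n+1) y = 0`.
    have hcomm : Commute (rieszProjection T 1 r) ((1 - T) ^ (n + 1)) :=
      (((Commute.one_left _).sub_left (commute_rieszProjection T 1 r)).pow_left (n + 1)).symm
    rw [← rieszProjection_apply_pow_eq_zero hr hD h1 y]
    exact (DFunLike.congr_fun hcomm.eq y).symm

end Riesz

/-! ### The autoregressive equation of order one -/

section OrderOne

variable (T : H →L[ℂ] H)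

theorem arFun_single (z : ℂ) : arFun ![T] z = 1 - z • T := by simp [arFun]

theorem arCoeff_single_zero : arCoeff ![T] 0 = 1 - T := by simp [arCoeff]

theorem arCoeff_single_one : arCoeff ![T] 1 = T := by simp [arCoeff]

theorem arCoeff_single_of_two_le (n : ℕ) (hn : 2 ≤ n) : arCoeff ![T] n = 0 := by
  obtain ⟨n, rfl⟩ := Nat.exists_eq_add_of_le' hn
  have : Nat.choose 1 (n + 1 + 1) = 0 := Nat.choose_eq_zero_of_lt (by omega)
  simp [arCoeff, this]

variable {T}

theorem HasUnitRootOfFiniteType.exists_isIsolatingRadius (hT : HasUnitRootOfFiniteType ![T]) :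
    ∃ r, IsIsolatingRadius T 1 r := by
  obtain ⟨ρ, hρ, hinv⟩ := hT.invertible
  obtain ⟨v, hv, hv0⟩ := hT.finiteType.exists_ker
  have hρ1 : ρ⁻¹ < 1 := inv_lt_one_of_one_lt₀ hρ
  have hρ0 : 0 < ρ⁻¹ := by positivity
  -- Half the gap keeps the disc in `|w| > ρ⁻¹`, where `w - T = w A(w⁻¹)` with `|w⁻¹| < ρ`.
  refine ⟨(1 - ρ⁻¹) / 2, by linarith, ?_⟩
  refine Set.eq_singleton_iff_unique_mem.2
    ⟨⟨Metric.mem_closedBall_self (by linarith), fun hu => ?_⟩, ?_⟩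
  · have hu1 : (1 : ℂ) ∈ resolventSet ℂ T := hu
    have h := resolvent_apply_sub hu1 v
    rw [arFun_single, one_smul] at hv0
    have hv1 : (1 : ℂ) • v - T v = 0 := by
      rw [one_smul]
      exact hv0
    rw [hv1, map_zero] at h
    exact hv h.symm
  · rintro w ⟨hw, hspec⟩
    by_contra hne
    rw [Metric.mem_closedBall, dist_comm, dist_eq_norm] at hw
    have hnorm : ρ⁻¹ < ‖w‖ := by
      have := norm_sub_norm_le (1 : ℂ) w
      rw [norm_one] at this
      linarith
    have hw0 : w ≠ 0 := norm_pos_iff.1 (hρ0.trans hnorm)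
    have hz : w⁻¹ ∈ Metric.ball (0 : ℂ) ρ := by
      rw [mem_ball_zero_iff, norm_inv]
      exact inv_lt_of_inv_lt₀ (by linarith) hnorm
    have hunit := hinv _ hz (by simpa using hne)
    refine hspec (spectrum.mem_resolventSet_iff.2 ?_)
    have h1 : algebraMap ℂ (H →L[ℂ] H) w - T = Units.mk0 w hw0 • arFun ![T] w⁻¹ := by
      rw [arFun_single, Algebra.algebraMap_eq_smul_one, smul_sub]
      change _ = w • (1 : H →L[ℂ] H) - w • w⁻¹ • T
      rw [smul_inv_smul₀ hw0]
    rw [h1]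
    exact hunit.smul _

end OrderOne

end FunctionalAR

end

theorem mainTheorem8 {H : Type*} [NormedAddCommGroup H] [InnerProductSpace ℂ H] [CompleteSpace H]
    (A₁ : H →L[ℂ] H) (hA : FunctionalAR.HasUnitRootOfFiniteType ![A₁])
    (d : ℕ) (hd : 1 ≤ d) :
    (∃ r : ℝ, FunctionalAR.IsIsolatingRadius A₁ 1 r) ∧
    ∀ r : ℝ, FunctionalAR.IsIsolatingRadius A₁ 1 r →
      (FunctionalAR.HuParkCondition A₁ r d ↔ FunctionalAR.PoleCondition ![A₁] d) := by
  refine ⟨hA.exists_isIsolatingRadius, fun r hr => ?_⟩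
  obtain ⟨n, rfl⟩ := Nat.exists_eq_add_of_le' hd
  have hF := hA.finiteType.isFredholm
  rw [FunctionalAR.arFun_single, one_smul] at hF
  have h0 := FunctionalAR.arCoeff_single_zero A₁
  have h1 := FunctionalAR.arCoeff_single_one A₁
  have h2 := FunctionalAR.arCoeff_single_of_two_le A₁
  have hker : FiniteDimensional ℂ (1 - A₁).ker := hF.finite_ker
  have hker' : FiniteDimensional ℂ (FunctionalAR.arCoeff ![A₁] 0).ker := by rwa [h0]
  have hcl := FunctionalAR.isClosed_range_lrfS (FunctionalAR.arCoeff ![A₁])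
    (by rw [h0]; exact hF.isClosed_range)
  rw [FunctionalAR.huParkCondition_succ_iff hr hF.isClosed_range, FunctionalAR.PoleCondition,
    FunctionalAR.poleDecomposition_iff hcl, Ne,
    FunctionalAR.commonKer_pencil_eq_bot_iff h0 h1 h2 hcl,
    FunctionalAR.commonKer_pencil_eq_bot_iff h0 h1 h2 hcl]
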